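/- Consider Winfree's abstract Tile Assembly Model in the plane. A glue is a pair consisting of a finite string over a fixed alphabet (the label) and a non-negative integer (the strength). A tile type assigns a glue to each of the four sides of a non-rotatable unit square. Two tiles at adjacent points of $\mathbb{Z}^2$ bind if their abutting glues are equal (in label and strength) and have positive strength. A configuration is a partial function $\alpha$ from $\mathbb{Z}^2$ to tile types. Its binding graph has vertex set $\mathrm{dom}\,\alpha$ and an edge between two adjacent positions whenever their tiles bind, with the strength of the common glue as weight. An assembly is a configuration with connected, non-empty binding graph. It is $\tau$-stable if every cut of its binding graph has weight at least $\tau$. A singly-seeded tile assembly system $\mathcal{T}=(T,\sigma,\tau)$ consists of a finite set $T$ of tile types, a seed assembly $\sigma$ made of one tile of $T$ placed at some point of $\mathbb{Z}^2$, and a temperature $\tau\in\mathbb{Z}^+$. Starting from $\sigma$, tiles of types in $T$ are attached one at a time, each step leading from a $\tau$-stable assembly to a $\tau$-stable assembly. The producible assemblies are the results of the finite or infinite sequences of such steps. An assembly is terminal if it is $\tau$-stable and no further tile can be attached. A shape $X\subseteq\mathbb{Z}^2$ self-assembles in $\mathcal{T}$ if every producible terminal assembly has domain exactly $X$ (there may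 be several such assemblies). The tile complexity $K^{\tau}_{SA}(X)$ is the minimum of $|T|$ over all singly-seeded systems $(T,\sigma,\tau)$ of temperature $\tau$ in which $X$ self-assembles. Theorem. Let $R_{k,N}=\{0,1,\dots,N-1\}\times\{0,1,\dots,k-1\}$ be the $k\times N$ rectangle. Then $K^{1}_{SA}(R_{k,N})=\Omega(N^{1/k})$; that is, there is an absolute constant $c>0$, independent of $k$, $N$ and the alphabet, such that for all integers $k,N\ge 1$ $$K^{1}_{SA}(R_{k,N})\ \ge\ c\,N^{1/k}.$$ In other words, every singly-seeded temperature-1 system in which $R_{k,N}$ self-assembles, directed or not, has at least $c\,N^{1/k}$ tile types. -/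

import Mathlib

open scoped ENNReal

namespace ATAM

universe u

/-- The four sides of a unit square tile. -/
inductive Dir where
  | north | east | south | west
  deriving DecidableEq

/-- The unit vector pointing out of a side. -/
def Dir.vec : Dir → ℤ × ℤ
  | .north => (0, 1)
  | .east => (1, 0)
  | .south => (0, -1)
  | .west => (-1, 0)

/-- The opposite side. -/
def Dir.opp : Dir → Dir
  | .north => .south
  | .east => .west
  | .south => .north
  | .west => .east

theorem Dir.opp_opp (d : Dir) : d.opp.opp = d := by cases d <;> rfl

theorem Dir.vec_opp (d : Dir) : d.opp.vec = -d.vec := by cases d <;> rfl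

/-- A glue: a finite string over the alphabet `A` (the label) and a non-negative integer
strength. -/
@[ext]
structure Glue (A : Type u) where
  label : List A
  strength : ℕ

/-- A two-dimensional tile type: one glue for each side (tiles do not rotate). -/
abbrev TileType (A : Type u) : Type u := Dir → Glue A

/-- A configuration: a partial function from the integer lattice to tile types. -/
abbrev Config (A : Type u) : Type u := ℤ × ℤ → Option (TileType A)

variable {A : Type u}

/-- The set of positions that carry a tile. -/
def Config.dom (α : Config A) : Set (ℤ × ℤ) := {p | ∃ t, α p = some t}

/-- The tile at `p` and the tile at its neighbour in direction `d` are both present and bind: their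
abutting glues are equal (in label and in strength) and have positive strength. -/
def Config.Binds (α : Config A) (p : ℤ × ℤ) (d : Dir) : Prop :=
  ∃ t t', α p = some t ∧ α (p + d.vec) = some t' ∧ t d = t' d.opp ∧ 0 < (t d).strength

theorem Config.Binds.symm {α : Config A} {p : ℤ × ℤ} {d : Dir} (h : α.Binds p d) :
    α.Binds (p + d.vec) d.opp := by
  obtain ⟨t, t', h1, h2, h3, h4⟩ := h
  refine ⟨t', t, h2, ?_, ?_, h3 ▸ h4⟩
  · rw [Dir.vec_opp, add_neg_cancel_right, h1]
  · rw [Dir.opp_opp, h3]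

/-- The binding graph of a configuration: the vertices are the occupied positions, and two adjacent
positions are joined by an edge if their tiles bind. -/
def Config.bindingGraph (α : Config A) : SimpleGraph α.dom where
  Adj p q := ∃ d : Dir, q.1 = p.1 + d.vec ∧ α.Binds p.1 d
  symm := ⟨by
    rintro p q ⟨d, hq, hb⟩
    exact ⟨d.opp, by rw [hq, Dir.vec_opp, add_neg_cancel_right], hq ▸ hb.symm⟩⟩
  loopless := ⟨by
    rintro p ⟨d, hp, -⟩
    have h0 : d.vec = 0 := left_eq_add.mp hp
    cases d <;> simp [Dir.vec] at h0⟩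

open Classical in
/-- The weight of the edge of the binding graph leaving `p` in direction `d`: the strength of the
glue it represents (and `0` if there is no such edge). -/
noncomputable def Config.bondStrength (α : Config A) (p : ℤ × ℤ) (d : Dir) : ℕ :=
  match α p with
  | some t => if α.Binds p d then (t d).strength else 0
  | none => 0

/-- The total weight of the edges of the binding graph that have exactly one endpoint in `S`, each
edge being counted once, from its endpoint in `S`. -/
noncomputable def Config.cutWeight (α : Config A) (S : Set (ℤ × ℤ)) : ℝ≥0∞ :=
  ∑' e : {e : (ℤ × ℤ) × Dir // e.1 ∈ S ∧ e.1 + e.2.vec ∉ S}, (α.bondStrength e.1.1 e.1.2 : ℝ≥0∞)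

/-- `α` is `τ`-stable: whenever its positions are divided into two non-empty parts, the edges of the
binding graph between the two parts have total weight at least `τ`. -/
def Config.Stable (τ : ℕ) (α : Config A) : Prop :=
  ∀ S ⊆ α.dom, S.Nonempty → (α.dom \ S).Nonempty → (τ : ℝ≥0∞) ≤ α.cutWeight S

/-- `α` is an assembly of tiles from `T`: it uses only tile types in `T`, its binding graph is
connected and its domain is non-empty (`SimpleGraph.Connected` includes the latter). -/
def Config.IsAssembly (T : Finset (TileType A)) (α : Config A) : Prop :=
  (∀ p t, α p = some t → t ∈ T) ∧ α.bindingGraph.Connected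

/-- `α` is a subassembly of `β`. -/
def Config.Sub (α β : Config A) : Prop := ∀ p t, α p = some t → β p = some t

/-- A two-dimensional tile assembly system: a finite tile set, a finite stable seed assembly and a
positive temperature. -/
structure TAS (A : Type u) where
  tiles : Finset (TileType A)
  seed : Config A
  temp : ℕ
  temp_pos : 0 < temp
  seed_finite : seed.dom.Finite
  seed_assembly : seed.IsAssembly tiles
  seed_stable : seed.Stable temp

namespace TAS

variable (𝒯 : TAS A)

/-- The seed assembly consists of a single tile (at an arbitrary position). -/
def SinglySeeded : Prop := ∃ p, 𝒯.seed.dom = {p}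

/-- `α` is a `τ`-stable assembly of tiles of the system. -/
def StableAssembly (α : Config A) : Prop := α.IsAssembly 𝒯.tiles ∧ α.Stable 𝒯.temp

/-- `α` produces `β` in one step: both are stable assemblies, `α` is a subassembly of `β`, and `β`
has exactly one more tile. -/
def Step (α β : Config A) : Prop :=
  𝒯.StableAssembly α ∧ 𝒯.StableAssembly β ∧ α.Sub β ∧ ∃ p, β.dom \ α.dom = {p}

/-- `α` produces `β` in zero or more steps, possibly infinitely many: there is an assembly sequence
`a 0, a 1, …` of length `|dom β \ dom α| + 1` that starts with `α`, all of whose members are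
subassemblies of `β`, and whose domains exhaust that of `β`. The values `a i` with `i` not less than
the length play no role. -/
def Produces (α β : Config A) : Prop :=
  ∃ (a : ℕ → Config A) (len : ℕ∞), len = (β.dom \ α.dom).encard + 1 ∧
    (∀ i : ℕ, ((i + 1 : ℕ) : ℕ∞) < len → 𝒯.Step (a i) (a (i + 1))) ∧
    a 0 = α ∧
    β.dom = ⋃ (i : ℕ) (_ : (i : ℕ∞) < len), (a i).dom ∧
    ∀ i : ℕ, (i : ℕ∞) < len → (a i).Sub β

/-- The producible assemblies. -/
def Producible (α : Config A) : Prop := 𝒯.Produces 𝒯.seed α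

/-- The frontier of `α`: the empty positions at which a tile could stably attach. -/
def frontier (α : Config A) : Set (ℤ × ℤ) := ⋃ (β : Config A) (_ : 𝒯.Step α β), β.dom \ α.dom

/-- `α` is terminal: it is a stable assembly and no tile can stably attach to it. -/
def Terminal (α : Config A) : Prop := 𝒯.StableAssembly α ∧ 𝒯.frontier α = ∅

/-- The shape `X` self-assembles in the system: every producible terminal assembly has domain `X`.
There may be more than one such assembly. -/
def SelfAssembles (X : Set (ℤ × ℤ)) : Prop :=
  ∀ α, 𝒯.Producible α → 𝒯.Terminal α → α.dom = X

end TAS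

/-- The tile complexity of the shape `X` at temperature `τ` (with glue labels over the alphabet
`A`): the minimum number of tile types of a singly-seeded system of temperature `τ` in which `X`
self-assembles. (By convention the value is `0` if there is no such system, so a positive lower bound
on it includes that there is one.) -/
noncomputable def tileComplexity (A : Type u) (τ : ℕ) (X : Set (ℤ × ℤ)) : ℕ :=
  sInf {n | ∃ 𝒯 : TAS A, 𝒯.SinglySeeded ∧ 𝒯.temp = τ ∧ 𝒯.tiles.card = n ∧ 𝒯.SelfAssembles X}

/-- The `k × N` rectangle `{0, …, N - 1} × {0, …, k - 1}`, with `N` columns and `k` rows. -/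
def rectangle (k N : ℕ) : Set (ℤ × ℤ) := {p | 0 ≤ p.1 ∧ p.1 < N ∧ 0 ≤ p.2 ∧ p.2 < k}

end ATAM

/-! At temperature 1, stability is just connectedness of the binding graph. Hence every connected
configuration of tiles from the system that contains the seed is producible, and by Zorn's lemma it
extends to a producible terminal assembly (`exists_terminal`). If the rectangle self-assembles, no
such configuration can leave it.

Fix one terminal assembly `β` on the rectangle, the seed position `s`, and a position `t` in an end
column. A path of bonds from `s` to `t` is kept only as a set of edges modulo 2 with boundary `s +
t`. For each column from that of `s` up to but not including that of `t`, record the tiles of the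
column and which outgoing horizontal edges are marked: at most `(2|T|)^k` values. If two columns at
signed positions `i < j` agree, keep everything up to `j` and append the part beyond `i`, shifted
outward by `j - i`. Tiles and marks fit at the seam, so the spliced edges are bonds with boundary `s
+ t'`, where `t'` is the shifted `t` (`IsChain.splice`). The spliced configuration may be
disconnected, but a finite edge set has even boundary in every component, so `t'` lies in the
component of `s` (`IsChain.mem_component`). That component contains the seed and leaves the
rectangle, a contradiction.

So the seed is within `(2|T|)^k` of both end columns, which gives `N ≤ 3(2|T|)^k ≤ (6|T|)^k`.
Working modulo 2 makes the order in which a path crosses a column irrelevant: only the set of marked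
crossings has to repeat, at a cost of `2^k`.

Since `tileComplexity` is `0` when no system exists, a system that assembles the rectangle must also
be exhibited (`exists_selfAssembles`). -/

namespace ATAM

variable {A : Type*}

/-! ### Connectedness from a root, and stability at temperature 1 -/

/-- A set of positions is closed under the bonds of `α`. -/
def Config.Closed (α : Config A) (K : Set (ℤ × ℤ)) : Prop :=
  ∀ p ∈ K, ∀ d, α.Binds p d → p + d.vec ∈ K

/-- Every position of `α` can be reached from `s` along bonds. -/
def Config.Rooted (α : Config A) (s : ℤ × ℤ) : Prop :=
  s ∈ α.dom ∧ ∀ K, s ∈ K → α.Closed K → α.dom ⊆ K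

theorem Config.Binds.mem_left {α : Config A} {p : ℤ × ℤ} {d : Dir} (h : α.Binds p d) :
    p ∈ α.dom := by
  obtain ⟨t, _, h1, _⟩ := h
  exact ⟨t, h1⟩

theorem Config.Binds.mem_right {α : Config A} {p : ℤ × ℤ} {d : Dir} (h : α.Binds p d) :
    p + d.vec ∈ α.dom := by
  obtain ⟨_, t, _, h1, _⟩ := h
  exact ⟨t, h1⟩

theorem Config.Sub.dom_subset {α β : Config A} (h : α.Sub β) : α.dom ⊆ β.dom :=
  fun _ ⟨t, ht⟩ => ⟨t, h _ _ ht⟩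

theorem Config.Sub.binds {α β : Config A} (h : α.Sub β) {p : ℤ × ℤ} {d : Dir}
    (hb : α.Binds p d) : β.Binds p d := by
  obtain ⟨t, t', h1, h2, h3⟩ := hb
  exact ⟨t, t', h _ _ h1, h _ _ h2, h3⟩

theorem Config.Rooted.connected {α : Config A} {s : ℤ × ℤ} (h : α.Rooted s) :
    α.bindingGraph.Connected := by
  have key : ∀ p (hp : p ∈ α.dom), α.bindingGraph.Reachable ⟨s, h.1⟩ ⟨p, hp⟩ := by
    intro p hp
    have := h.2 {p | ∃ hp : p ∈ α.dom, α.bindingGraph.Reachable ⟨s, h.1⟩ ⟨p, hp⟩}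
      ⟨h.1, SimpleGraph.Reachable.refl _⟩ (by
        rintro q ⟨hq, hr⟩ d hb
        refine ⟨hb.mem_right, hr.trans (SimpleGraph.Adj.reachable ?_)⟩
        exact ⟨d, rfl, hb⟩) hp
    exact this.2
  have : Nonempty α.dom := ⟨⟨s, h.1⟩⟩
  exact ⟨fun p q => (key p.1 p.2).symm.trans (key q.1 q.2)⟩

theorem Config.rooted_of_connected {α : Config A} (h : α.bindingGraph.Connected) {s : ℤ × ℤ}
    (hs : s ∈ α.dom) : α.Rooted s := by
  refine ⟨hs, fun K hsK hK p hp => ?_⟩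
  have hr := h.preconnected ⟨s, hs⟩ ⟨p, hp⟩
  obtain ⟨w⟩ := hr
  have : ∀ (a b : α.dom), α.bindingGraph.Walk a b → a.1 ∈ K → b.1 ∈ K := by
    intro a b w
    induction w with
    | nil => exact id
    | cons hadj _ ih =>
      intro ha
      obtain ⟨d, hd, hb⟩ := hadj
      exact ih (hd ▸ hK _ ha d hb)
  exact this _ _ w hsK

/-- A bond of a configuration leaves every proper non-empty part of a connected configuration. -/
theorem Config.Rooted.exists_binds {α : Config A} {s : ℤ × ℤ} (h : α.Rooted s)
    {S : Set (ℤ × ℤ)} (hS : S ⊆ α.dom) (hne : S.Nonempty) (hne' : (α.dom \ S).Nonempty) :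
    ∃ p ∈ S, ∃ d, α.Binds p d ∧ p + d.vec ∉ S := by
  by_contra! hcon
  obtain ⟨q, hq⟩ := hne
  obtain ⟨r, hr, hrS⟩ := hne'
  exact hrS ((rooted_of_connected h.connected (hS hq)).2 S hq hcon hr)

/-- A bond crosses every cut, and a single bond has strength at least 1, which is all that
temperature 1 demands. -/
theorem Config.Rooted.stable {α : Config A} {s : ℤ × ℤ} (h : α.Rooted s) : α.Stable 1 := by
  intro S hS hne hne'
  obtain ⟨p, hp, d, hb, hd⟩ := h.exists_binds hS hne hne'
  unfold cutWeight
  refine le_trans ?_ (ENNReal.le_tsum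
    (⟨(p, d), hp, hd⟩ : {e : (ℤ × ℤ) × Dir // e.1 ∈ S ∧ e.1 + e.2.vec ∉ S}))
  have hb' := hb
  obtain ⟨t, t', h1, h2, h3, h4⟩ := hb'
  have : 1 ≤ α.bondStrength p d := by
    simp only [bondStrength, h1, if_pos hb]
    exact h4
  exact_mod_cast this

open Classical in
/-- The restriction of a configuration to a set of positions. -/
noncomputable def Config.restrict (α : Config A) (S : Set (ℤ × ℤ)) : Config A :=
  fun p => if p ∈ S then α p else none

theorem Config.restrict_eq_some {α : Config A} {S : Set (ℤ × ℤ)} {p : ℤ × ℤ} {t : TileType A} :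
    α.restrict S p = some t ↔ p ∈ S ∧ α p = some t := by
  unfold restrict
  split_ifs with h <;> simp [h]

theorem Config.restrict_sub (α : Config A) (S : Set (ℤ × ℤ)) : (α.restrict S).Sub α :=
  fun _ _ h => (restrict_eq_some.1 h).2

theorem Config.restrict_sub_restrict (α : Config A) {S S' : Set (ℤ × ℤ)} (h : S ⊆ S') :
    (α.restrict S).Sub (α.restrict S') := by
  intro p t hp
  rw [restrict_eq_some] at hp ⊢
  exact ⟨h hp.1, hp.2⟩

theorem Config.dom_restrict {α : Config A} {S : Set (ℤ × ℤ)} (h : S ⊆ α.dom) :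
    (α.restrict S).dom = S := by
  ext p
  constructor
  · rintro ⟨t, ht⟩
    exact (restrict_eq_some.1 ht).1
  · intro hp
    obtain ⟨t, ht⟩ := h hp
    exact ⟨t, restrict_eq_some.2 ⟨hp, ht⟩⟩

theorem Config.binds_restrict {α : Config A} {S : Set (ℤ × ℤ)} {p : ℤ × ℤ} {d : Dir} :
    (α.restrict S).Binds p d ↔ α.Binds p d ∧ p ∈ S ∧ p + d.vec ∈ S := by
  simp only [Binds, restrict_eq_some]
  grind

theorem Config.Rooted.restrict_insert {α : Config A} {s : ℤ × ℤ} {S : Set (ℤ × ℤ)} (hS : S ⊆ α.dom)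
    (h : (α.restrict S).Rooted s) {p : ℤ × ℤ} {d : Dir} (hp : p ∈ S) (hb : α.Binds p d) :
    (α.restrict (insert (p + d.vec) S)).Rooted s := by
  have hI : insert (p + d.vec) S ⊆ α.dom := Set.insert_subset hb.mem_right hS
  have hsub := α.restrict_sub_restrict (Set.subset_insert (p + d.vec) S)
  refine ⟨hsub.dom_subset h.1, fun K hsK hK => ?_⟩
  rw [dom_restrict hI]
  have hSK : S ⊆ K := by
    have := h.2 K hsK (fun q hq d hb => hK q hq d (hsub.binds hb))
    rwa [dom_restrict hS] at this
  refine Set.insert_subset (hK p (hSK hp) d ?_) hSK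
  rw [binds_restrict]
  exact ⟨hb, Set.mem_insert_of_mem _ hp, Set.mem_insert _ _⟩

/-- The positions reachable from `s` along bonds. -/
def Config.component (α : Config A) (s : ℤ × ℤ) : Set (ℤ × ℤ) :=
  {p | ∀ K, s ∈ K → α.Closed K → p ∈ K}

theorem Config.closed_component (α : Config A) (s : ℤ × ℤ) : α.Closed (α.component s) :=
  fun p hp d hb K hs hK => hK p (hp K hs hK) d hb

theorem Config.self_mem_component (α : Config A) (s : ℤ × ℤ) : s ∈ α.component s :=
  fun _ hs _ => hs

theorem Config.component_subset {α : Config A} {s : ℤ × ℤ} (hs : s ∈ α.dom) :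
    α.component s ⊆ α.dom :=
  fun _ hp => hp _ hs fun _ _ _ hb => hb.mem_right

theorem Config.rooted_restrict_component {α : Config A} {s : ℤ × ℤ} (hs : s ∈ α.dom) :
    (α.restrict (α.component s)).Rooted s := by
  have hd := dom_restrict (component_subset hs)
  refine ⟨hd.symm ▸ α.self_mem_component s, fun K hsK hK => ?_⟩
  rw [hd]
  intro p hp
  refine (hp (K ∩ α.component s) ⟨hsK, α.self_mem_component s⟩ ?_).1
  rintro q ⟨hq, hqC⟩ d hb
  have hC := α.closed_component s q hqC d hb
  exact ⟨hK q hq d (binds_restrict.2 ⟨hb, hqC, hC⟩), hC⟩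

/-! ### Greedy enumeration of a connected configuration -/

/-- The positions at which a tile of `β` can be attached to the part of `β` on `S`. -/
def Config.candidates (β : Config A) (S : Set (ℤ × ℤ)) : Set (ℤ × ℤ) :=
  {q | q ∉ S ∧ ∃ p ∈ S, ∃ d : Dir, q = p + d.vec ∧ β.Binds p d}

open Classical in
/-- The set `S` with the candidate of least code added (if there is a candidate). -/
noncomputable def Config.grow (β : Config A) (S : Set (ℤ × ℤ)) : Set (ℤ × ℤ) :=
  if h : (β.candidates S).Nonempty then
    insert (Function.argminOn (Encodable.encode : ℤ × ℤ → ℕ) (β.candidates S) h) S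
  else S

theorem Config.grow_spec {β : Config A} {S : Set (ℤ × ℤ)} (h : (β.candidates S).Nonempty) :
    ∃ q ∈ β.candidates S, β.grow S = insert q S ∧
      ∀ r ∈ β.candidates S, Encodable.encode q ≤ Encodable.encode r := by
  refine ⟨_, Function.argminOn_mem (Encodable.encode : ℤ × ℤ → ℕ) (β.candidates S) h, ?_, ?_⟩
  · simp only [grow, dif_pos h]
  · intro r hr
    exact Function.argminOn_le _ _ hr

theorem Config.subset_grow (β : Config A) (S : Set (ℤ × ℤ)) : S ⊆ β.grow S := by
  unfold grow
  split_ifs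
  · exact Set.subset_insert _ _
  · exact subset_rfl

/-- The greedy exhaustion of a configuration from the position `s`. -/
noncomputable def Config.greedy (β : Config A) (s : ℤ × ℤ) (n : ℕ) : Set (ℤ × ℤ) :=
  β.grow^[n] {s}

theorem Config.greedy_succ (β : Config A) (s : ℤ × ℤ) (n : ℕ) :
    β.greedy s (n + 1) = β.grow (β.greedy s n) :=
  Function.iterate_succ_apply' _ _ _

theorem Config.greedy_mono (β : Config A) (s : ℤ × ℤ) : Monotone (β.greedy s) :=
  monotone_nat_of_le_succ fun n => by
    rw [greedy_succ]
    exact β.subset_grow _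

section Greedy

variable {β : Config A} {s : ℤ × ℤ}

theorem Config.Rooted.restrict_greedy (h : β.Rooted s) (n : ℕ) :
    β.greedy s n ⊆ β.dom ∧ (β.restrict (β.greedy s n)).Rooted s := by
  induction n with
  | zero =>
    have h0 : β.greedy s 0 = {s} := rfl
    have hsub : ({s} : Set (ℤ × ℤ)) ⊆ β.dom := Set.singleton_subset_iff.2 h.1
    rw [h0]
    refine ⟨hsub, ?_, fun K hs _ => ?_⟩
    · rw [dom_restrict hsub]
      rfl
    · rw [dom_restrict hsub]
      exact Set.singleton_subset_iff.2 hs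
  | succ n ih =>
    rw [greedy_succ]
    by_cases hc : (β.candidates (β.greedy s n)).Nonempty
    · obtain ⟨q, ⟨-, p, hp, d, rfl, hb⟩, heq, -⟩ := grow_spec hc
      rw [heq]
      exact ⟨Set.insert_subset hb.mem_right ih.1, ih.2.restrict_insert ih.1 hp hb⟩
    · rw [grow, dif_neg hc]
      exact ih

theorem Config.mem_greedy (β : Config A) (s : ℤ × ℤ) (n : ℕ) : s ∈ β.greedy s n :=
  β.greedy_mono s (Nat.zero_le n) rfl

theorem Config.Rooted.candidates_nonempty (h : β.Rooted s) {n : ℕ}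
    (hne : β.greedy s n ≠ β.dom) : (β.candidates (β.greedy s n)).Nonempty := by
  have hsub := (h.restrict_greedy n).1
  obtain ⟨p, hp, d, hb, hd⟩ := h.exists_binds hsub ⟨s, β.mem_greedy s n⟩
    (Set.sdiff_nonempty.2 fun h' => hne (hsub.antisymm h'))
  exact ⟨_, hd, p, hp, d, rfl, hb⟩

theorem Config.Rooted.encard_greedy (h : β.Rooted s) (n : ℕ) (hn : (n : ℕ∞) < β.dom.encard) :
    (β.greedy s n).encard = n + 1 := by
  induction n with
  | zero => simp [greedy]
  | succ n ih =>
    have hlt : (n : ℕ∞) < β.dom.encard := lt_of_le_of_lt (by exact_mod_cast n.le_succ) hn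
    have hne : β.greedy s n ≠ β.dom := by
      intro he
      rw [← he, ih hlt] at hn
      exact absurd hn (by push_cast; exact lt_irrefl _)
    obtain ⟨q, hq, heq, -⟩ := grow_spec (h.candidates_nonempty hne)
    rw [greedy_succ, heq, Set.encard_insert_of_notMem hq.1, ih hlt]
    push_cast
    rfl

/-- Choosing the least code makes the enumeration fair: a candidate that is never added would force
infinitely many distinct positions to have codes below its own. -/
theorem Config.Rooted.iUnion_greedy (h : β.Rooted s) : ⋃ n, β.greedy s n = β.dom := by
  have hsub : (⋃ n, β.greedy s n) ⊆ β.dom := Set.iUnion_subset fun n => (h.restrict_greedy n).1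
  refine hsub.antisymm ?_
  by_contra hcon
  obtain ⟨p, hp, d, hb, hd⟩ := h.exists_binds hsub
    ⟨s, Set.mem_iUnion.2 ⟨0, β.mem_greedy s 0⟩⟩ (Set.sdiff_nonempty.2 hcon)
  obtain ⟨m, hm⟩ := Set.mem_iUnion.1 hp
  have hcand : ∀ n, p + d.vec ∈ β.candidates (β.greedy s (m + n)) := fun n =>
    ⟨fun h' => hd (Set.mem_iUnion.2 ⟨_, h'⟩), p, β.greedy_mono s (Nat.le_add_right m n) hm, d,
      rfl, hb⟩
  -- `q n` is the position added at stage `m + n`; the neglected position is a candidate at each of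
  -- these stages, so its code bounds all of theirs.
  choose q hq heq hle using fun n => grow_spec ⟨_, hcand n⟩
  have hmem : ∀ a b, a < b → q a ∈ β.greedy s (m + b) := by
    intro a b hab
    refine β.greedy_mono s (show m + a + 1 ≤ m + b by omega) ?_
    rw [greedy_succ, heq]
    exact Set.mem_insert _ _
  have hinj : Function.Injective (fun n => Encodable.encode (q n)) := by
    intro a b hab
    have hab : q a = q b := Encodable.encode_injective hab
    rcases lt_trichotomy a b with hlt | rfl | hlt
    · exact absurd (hab ▸ hmem a b hlt) (hq b).1
    · rfl
    · exact absurd (hab ▸ hmem b a hlt) (hq a).1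
  refine Set.infinite_range_of_injective hinj
    ((Set.finite_Iic (Encodable.encode (p + d.vec))).subset ?_)
  rintro _ ⟨n, rfl⟩
  exact hle n _ (hcand n)

end Greedy

/-! ### Producible and terminal assemblies at temperature 1 -/

namespace TAS

variable {𝒯 : TAS A}

/-- The greedy stages are connected, hence stable, and form an assembly sequence. The domain may be
infinite, since a maximal extension need not be finite. -/
theorem producible_of_rooted {s : ℤ × ℤ} (hs : 𝒯.seed.dom = {s}) (hτ : 𝒯.temp = 1)
    {β : Config A} (hT : ∀ p t, β p = some t → t ∈ 𝒯.tiles) (hβ : β.Rooted s)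
    (hsub : 𝒯.seed.Sub β) : 𝒯.Producible β := by
  have hdom : ∀ n, (β.restrict (β.greedy s n)).dom = β.greedy s n := fun n =>
    Config.dom_restrict (hβ.restrict_greedy n).1
  have hcard : (β.dom \ 𝒯.seed.dom).encard + 1 = β.dom.encard := by
    rw [hs]
    exact Set.encard_sdiff_singleton_add_one hβ.1
  have hst : ∀ n, 𝒯.StableAssembly (β.restrict (β.greedy s n)) := fun n =>
    ⟨⟨fun p t h => hT p t (β.restrict_sub _ p t h), (hβ.restrict_greedy n).2.connected⟩,
      hτ ▸ (hβ.restrict_greedy n).2.stable⟩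
  refine ⟨fun n => β.restrict (β.greedy s n), β.dom.encard, hcard.symm, ?_, ?_, ?_,
    fun n _ => β.restrict_sub _⟩
  · intro i hi
    refine ⟨hst i, hst (i + 1), β.restrict_sub_restrict (β.greedy_mono s i.le_succ), ?_⟩
    have hlt : (i : ℕ∞) < β.dom.encard := lt_of_le_of_lt (by exact_mod_cast i.le_succ) hi
    have hne : β.greedy s i ≠ β.dom := by
      intro he
      rw [← he, hβ.encard_greedy i hlt] at hi
      exact absurd hi (by push_cast; exact lt_irrefl _)
    obtain ⟨q, hq, heq, -⟩ := Config.grow_spec (hβ.candidates_nonempty hne)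
    refine ⟨q, ?_⟩
    rw [hdom, hdom, Config.greedy_succ, heq]
    ext x
    simp only [Set.mem_sdiff, Set.mem_insert_iff, Set.mem_singleton_iff]
    have := hq.1
    constructor
    · tauto
    · rintro rfl
      exact ⟨Or.inl rfl, this⟩
  · funext p
    by_cases hp : p = s
    · subst hp
      obtain ⟨t, ht⟩ : p ∈ 𝒯.seed.dom := hs ▸ rfl
      rw [ht]
      exact Config.restrict_eq_some.2 ⟨β.mem_greedy p 0, hsub _ _ ht⟩
    · have h1 : 𝒯.seed p = none := by
        by_contra hne
        obtain ⟨t, ht⟩ := Option.ne_none_iff_exists'.1 hne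
        have : p ∈ 𝒯.seed.dom := ⟨t, ht⟩
        rw [hs] at this
        exact hp this
      rw [h1]
      exact if_neg hp
  · simp only [hdom]
    refine subset_antisymm ?_ (Set.iUnion₂_subset fun n _ => (hβ.restrict_greedy n).1)
    by_cases hfin : β.dom.Finite
    · obtain ⟨m, hm⟩ : ∃ m : ℕ, β.dom.encard = (m + 1 : ℕ) := by
        refine ⟨β.dom.ncard - 1, ?_⟩
        have := (Set.ncard_pos hfin).2 ⟨s, hβ.1⟩
        rw [Nat.sub_add_cancel this, hfin.cast_ncard_eq]
      have hlt : (m : ℕ∞) < β.dom.encard := by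
        rw [hm]
        exact_mod_cast m.lt_succ_self
      have : β.greedy s m = β.dom := by
        refine Set.Finite.eq_of_subset_of_encard_le' hfin
          (hβ.restrict_greedy m).1 ?_
        rw [hβ.encard_greedy m hlt, hm]
        push_cast
        exact le_rfl
      intro p hp
      exact Set.mem_iUnion₂.2 ⟨m, hlt, this ▸ hp⟩
    · intro p hp
      rw [← hβ.iUnion_greedy] at hp
      obtain ⟨n, hn⟩ := Set.mem_iUnion.1 hp
      refine Set.mem_iUnion₂.2 ⟨n, ?_, hn⟩
      rw [Set.encard_eq_top hfin]
      exact ENat.natCast_lt_top n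

/-- At temperature `1`, every connected configuration containing the seed extends to a producible
terminal assembly. -/
theorem exists_terminal {s : ℤ × ℤ} (hs : 𝒯.seed.dom = {s}) (hτ : 𝒯.temp = 1)
    {γ : Config A} (hT : ∀ p t, γ p = some t → t ∈ 𝒯.tiles) (hγ : γ.Rooted s)
    (hsub : 𝒯.seed.Sub γ) : ∃ β, 𝒯.Producible β ∧ 𝒯.Terminal β ∧ γ.Sub β := by
  classical
  let P : Set (Config A) :=
    {β | (∀ p t, β p = some t → t ∈ 𝒯.tiles) ∧ β.Rooted s ∧ γ.Sub β}
  obtain ⟨⟨β, hβT, hβ, hγβ⟩, hmax⟩ := exists_maximal_of_chains_bounded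
    (r := fun a b : P => a.1.Sub b.1) (by
      intro c hc
      by_cases hne : c.Nonempty
      · let u : Config A := fun p =>
          if h : ∃ t, ∃ b ∈ c, b.1 p = some t then some h.choose else none
        have hu : ∀ b ∈ c, b.1.Sub u := by
          intro b hb p t ht
          have hex : ∃ t, ∃ b ∈ c, b.1 p = some t := ⟨t, b, hb, ht⟩
          obtain ⟨b', hb', ht'⟩ := hex.choose_spec
          have : hex.choose = t := by
            rcases eq_or_ne b b' with rfl | hbb
            · exact Option.some_injective _ (ht'.symm.trans ht)
            · rcases hc hb hb' hbb with h | h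
              · exact Option.some_injective _ (ht'.symm.trans (h _ _ ht))
              · exact Option.some_injective _ ((h _ _ ht').symm.trans ht)
          simp only [u, dif_pos hex, this]
        have hu' : ∀ p t, u p = some t → ∃ b ∈ c, b.1 p = some t := by
          intro p t ht
          by_cases hex : ∃ t, ∃ b ∈ c, b.1 p = some t
          · simp only [u, dif_pos hex, Option.some.injEq] at ht
            exact ht ▸ hex.choose_spec
          · simp only [u, dif_neg hex] at ht
            cases ht
        obtain ⟨b0, hb0⟩ := hne
        refine ⟨⟨u, ?_, ⟨(hu b0 hb0).dom_subset b0.2.2.1.1, ?_⟩, ?_⟩, hu⟩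
        · intro p t ht
          obtain ⟨b, hb, h⟩ := hu' p t ht
          exact b.2.1 p t h
        · rintro K hsK hK p ⟨t, ht⟩
          obtain ⟨b, hb, h⟩ := hu' p t ht
          exact b.2.2.1.2 K hsK (fun q hq d hbd => hK q hq d ((hu b hb).binds hbd)) ⟨t, h⟩
        · exact fun p t h => hu b0 hb0 _ _ (b0.2.2.2 p t h)
      · exact ⟨⟨γ, hT, hγ, fun _ _ h => h⟩, fun a ha => absurd ⟨a, ha⟩ hne⟩)
    (fun h1 h2 p t h => h2 p t (h1 p t h))
  refine ⟨β, producible_of_rooted hs hτ hβT hβ fun p t h => hγβ _ _ (hsub p t h),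
    ⟨⟨⟨hβT, hβ.connected⟩, hτ ▸ hβ.stable⟩, ?_⟩, hγβ⟩
  simp only [frontier, Set.iUnion_eq_empty]
  -- The result of any further attachment is again a competitor in the maximality of `β`, hence adds
  -- nothing.
  rintro β' ⟨-, hst, hsub', p, hp⟩
  have := hmax ⟨β', hst.1.1, Config.rooted_of_connected hst.1.2 (hsub'.dom_subset hβ.1),
    fun p t h => hsub' _ _ (hγβ p t h)⟩ hsub'
  exact Set.sdiff_eq_empty.2 this.dom_subset

end TAS

/-! ### Chains of bonds modulo 2 -/

/-- The indicator modulo `2` of the position `a`. -/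
def pointMass (a v : ℤ × ℤ) : ZMod 2 := if v = a then 1 else 0

theorem pointMass_self (a : ℤ × ℤ) : pointMass a a = 1 := if_pos rfl

theorem pointMass_of_ne {a v : ℤ × ℤ} (h : v ≠ a) : pointMass a v = 0 := if_neg h

/-- The boundary modulo `2` of a set of lattice edges: `h` marks the edges from `v` to `v + e`, and
`w` those from `v` to the position above `v`. -/
def chainBoundary (e : ℤ × ℤ) (h w : ℤ × ℤ → ZMod 2) (v : ℤ × ℤ) : ZMod 2 :=
  h v + h (v - e) + w v + w (v - (0, 1))

theorem chainBoundary_add (e : ℤ × ℤ) (h w h' w' : ℤ × ℤ → ZMod 2) (v : ℤ × ℤ) :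
    chainBoundary e (h + h') (w + w') v = chainBoundary e h w v + chainBoundary e h' w' v := by
  simp only [chainBoundary, Pi.add_apply]
  ring

theorem chainBoundary_single_left (e a v : ℤ × ℤ) :
    chainBoundary e (pointMass a) 0 v = pointMass a v + pointMass (a + e) v := by
  simp [chainBoundary, pointMass, sub_eq_iff_eq_add]

theorem chainBoundary_single_right (e a v : ℤ × ℤ) :
    chainBoundary e 0 (pointMass a) v = pointMass a v + pointMass (a + (0, 1)) v := by
  simp [chainBoundary, pointMass, sub_eq_iff_eq_add]

/-- The edges marked by `h` (in direction `D`) and `w` are bonds of `α`, and the boundary of this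
set of edges consists of `s` and `t`. -/
structure Config.IsChain (α : Config A) (D : Dir) (h w : ℤ × ℤ → ZMod 2) (s t : ℤ × ℤ) :
    Prop where
  left : ∀ v, h v ≠ 0 → α.Binds v D
  right : ∀ v, w v ≠ 0 → α.Binds v .north
  boundary : ∀ v, chainBoundary D.vec h w v = pointMass s v + pointMass t v

/-- Toggling one edge moves the endpoint from `t` to `b`. Stating the hypothesis on endpoints as an
identity of boundaries covers both directions of travel along the edge. -/
theorem Config.IsChain.add_left {α : Config A} {D : Dir} {h w : ℤ × ℤ → ZMod 2} {s t a b : ℤ × ℤ}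
    (H : α.IsChain D h w s t) (ha : α.Binds a D)
    (hb : ∀ v, (pointMass a v + pointMass (a + D.vec) v) =
      pointMass t v + pointMass b v) :
    α.IsChain D (h + pointMass a) w s b := by
  refine ⟨fun v hv => ?_, H.right, fun v => ?_⟩
  · by_cases hva : v = a
    · exact hva ▸ ha
    · exact H.left v (by simpa [pointMass, hva] using hv)
  · have := chainBoundary_add D.vec h w (pointMass a) 0 v
    rw [add_zero] at this
    rw [this, chainBoundary_single_left, hb, H.boundary]
    linear_combination CharTwo.add_self_eq_zero (pointMass t v : ZMod 2)

theorem Config.IsChain.add_right {α : Config A} {D : Dir} {h w : ℤ × ℤ → ZMod 2} {s t a b : ℤ × ℤ}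
    (H : α.IsChain D h w s t) (ha : α.Binds a .north)
    (hb : ∀ v, (pointMass a v + pointMass (a + (0, 1)) v) =
      pointMass t v + pointMass b v) :
    α.IsChain D h (w + pointMass a) s b := by
  refine ⟨H.left, fun v hv => ?_, fun v => ?_⟩
  · by_cases hva : v = a
    · exact hva ▸ ha
    · exact H.right v (by simpa [pointMass, hva] using hv)
  · have := chainBoundary_add D.vec h w 0 (pointMass a) v
    rw [add_zero] at this
    rw [this, chainBoundary_single_right, hb, H.boundary]
    linear_combination CharTwo.add_self_eq_zero (pointMass t v : ZMod 2)

/-- The set of endpoints of chains from `s` contains `s` (empty chain) and is closed under bonds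
(toggle the bond), so it contains the whole domain. -/
theorem Config.Rooted.exists_isChain {α : Config A} {s : ℤ × ℤ} (hα : α.Rooted s) {D : Dir}
    (hD : D = .east ∨ D = .west) {t : ℤ × ℤ} (ht : t ∈ α.dom) :
    ∃ h w, α.IsChain D h w s t := by
  refine hα.2 {t | ∃ h w, α.IsChain D h w s t} ?_ ?_ ht
  · refine ⟨0, 0, fun v hv => absurd rfl hv, fun v hv => absurd rfl hv, fun v => ?_⟩
    rw [CharTwo.add_self_eq_zero]
    simp [chainBoundary]
  · rintro p ⟨h, w, H⟩ d hb
    have hd : d = D ∨ d = D.opp ∨ d = .north ∨ d = .south := by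
      rcases hD with rfl | rfl <;> cases d <;> simp [Dir.opp]
    rcases hd with rfl | rfl | rfl | rfl
    · exact ⟨_, _, H.add_left hb fun v => rfl⟩
    · have hb' := hb.symm
      rw [Dir.opp_opp] at hb'
      refine ⟨_, _, H.add_left hb' fun v => ?_⟩
      rw [Dir.vec_opp, neg_add_cancel_right, add_comm]
    · exact ⟨_, _, H.add_right hb fun v => rfl⟩
    · refine ⟨_, _, H.add_right hb.symm fun v => ?_⟩
      have : p + Dir.south.vec + (0, 1) = p := by
        rw [add_assoc]
        exact add_zero p
      rw [this, add_comm]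

/-- Each edge has two endpoints, so the total boundary of a finite edge set vanishes modulo 2. -/
theorem finsum_add_comp_sub {h : ℤ × ℤ → ZMod 2} (hh : (Function.support h).Finite) (e : ℤ × ℤ) :
    ∑ᶠ v, (h v + h (v - e)) = 0 := by
  have h2 : (Function.support fun v => h (v - e)).Finite :=
    hh.preimage (f := fun v => v - e) (sub_left_injective.injOn)
  have : ∑ᶠ v, h (v - e) = ∑ᶠ v, h v := finsum_comp_equiv (Equiv.subRight e)
  rw [finsum_add_distrib hh h2, this]
  exact CharTwo.add_self_eq_zero _

theorem Config.binds_mem_component_iff {α : Config A} {s v : ℤ × ℤ} {d : Dir} (h : α.Binds v d) :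
    v ∈ α.component s ↔ v + d.vec ∈ α.component s := by
  refine ⟨fun hv => α.closed_component s v hv d h, fun hv => ?_⟩
  have := α.closed_component s _ hv _ h.symm
  rwa [Dir.vec_opp, add_neg_cancel_right] at this

/-- By parity, a chain with boundary `s + t` connects `s` to `t`. -/
theorem Config.IsChain.mem_component {α : Config A} {D : Dir} {h w : ℤ × ℤ → ZMod 2}
    {s t : ℤ × ℤ} (H : α.IsChain D h w s t) (hfin : α.dom.Finite) (hs : s ∈ α.dom) :
    t ∈ α.component s := by
  classical
  by_contra ht
  set C := α.component s with hC
  have hCfin : C.Finite := hfin.subset (component_subset hs)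
  have hfs : ∀ f : ℤ × ℤ → ZMod 2, (Function.support fun v => if v ∈ C then f v else 0).Finite :=
    fun f => hCfin.subset fun v hv => by
      by_contra hvC
      exact hv (if_neg hvC)
  -- No marked edge leaves the component `C`, so the chain restricted to `C` has boundary `s` alone
  -- if `t ∉ C`; its total would be 1 instead of 0.
  have key : ∀ v, ((if v ∈ C then h v else 0) + (if v - D.vec ∈ C then h (v - D.vec) else 0)) +
      ((if v ∈ C then w v else 0) + (if v - (0, 1) ∈ C then w (v - (0, 1)) else 0)) =
      (pointMass s v : ZMod 2) := by
    intro v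
    have h1 : (if v - D.vec ∈ C then h (v - D.vec) else 0) =
        if v ∈ C then h (v - D.vec) else 0 := by
      by_cases h0 : h (v - D.vec) = 0
      · simp [h0]
      · have := binds_mem_component_iff (s := s) (H.left _ h0)
        rw [sub_add_cancel] at this
        simp only [hC, this]
    have h2 : (if v - (0, 1) ∈ C then w (v - (0, 1)) else 0) =
        if v ∈ C then w (v - (0, 1)) else 0 := by
      by_cases h0 : w (v - (0, 1)) = 0
      · simp [h0]
      · have : v - (0, 1) ∈ C ↔ v - (0, 1) + (0, 1) ∈ C :=
          binds_mem_component_iff (s := s) (H.right _ h0)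
        rw [sub_add_cancel] at this
        simp only [this]
    rw [h1, h2]
    by_cases hv : v ∈ C
    · have hb := H.boundary v
      have hvt : v ≠ t := fun h' => ht (h' ▸ hv)
      rw [pointMass_of_ne hvt, add_zero, chainBoundary] at hb
      simp only [if_pos hv]
      rw [← hb]
      ring
    · have hvs : v ≠ s := fun h' => hv (h' ▸ α.self_mem_component s)
      simp [hv, pointMass_of_ne hvs]
  have hsum := finsum_congr key
  have hs1 : ∑ᶠ v, (pointMass s v : ZMod 2) = 1 := by
    rw [finsum_eq_single _ s fun v hv => pointMass_of_ne hv, pointMass_self]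
  have hfin2 : ∀ (f : ℤ × ℤ → ZMod 2) (e : ℤ × ℤ), (Function.support f).Finite →
      (Function.support fun v => f v + f (v - e)).Finite := fun f e hf =>
    (hf.union (hf.preimage (f := fun v => v - e) (sub_left_injective.injOn))).subset
      (Function.support_add _ _)
  rw [finsum_add_distrib (hfin2 _ D.vec (hfs h)) (hfin2 _ (0, 1) (hfs w)),
    finsum_add_comp_sub (hfs h), finsum_add_comp_sub (hfs w), hs1] at hsum
  exact absurd hsum (by decide)

/-! ### Splicing at a repeated column -/

/-- Cut along the column `j` and glue to it the part beyond the column `i`. -/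
def splice {β : Type*} (ε i j : ℤ) (f : ℤ × ℤ → β) (v : ℤ × ℤ) : β :=
  if ε * v.1 ≤ j then f v else f (v - (ε * (j - i), 0))

section Splice

variable {α : Config A} {D : Dir} {h w : ℤ × ℤ → ZMod 2} {s t : ℤ × ℤ} {ε i j : ℤ}

/-- When `f` repeats on the columns `i` and `j`, column `j` may be read as belonging to either side
of the seam. -/
theorem splice_of_le {β : Type*} {f : ℤ × ℤ → β}
    (heq : ∀ v : ℤ × ℤ, ε * v.1 = j → f v = f (v - (ε * (j - i), 0))) {v : ℤ × ℤ}
    (hv : j ≤ ε * v.1) : splice ε i j f v = f (v - (ε * (j - i), 0)) := by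
  unfold splice
  split_ifs with hle
  · exact heq v (le_antisymm hle hv)
  · rfl

/-- Only tiles and horizontal marks need to repeat: a horizontal edge leaving column `j` enters the
shifted part, whereas vertical edges never cross the seam. Here `ε` is the sign of the direction
`D`, so `ε * v.1` increases away from the seed. -/
theorem Config.IsChain.splice (H : α.IsChain D h w s t) (hD : D.vec = (ε, 0)) (hε : ε * ε = 1)
    (hij : i < j) (hs : ε * s.1 ≤ i) (ht : j < ε * t.1)
    (hα : ∀ v : ℤ × ℤ, ε * v.1 = j → α v = α (v - (ε * (j - i), 0)))
    (hh : ∀ v : ℤ × ℤ, ε * v.1 = j → h v = h (v - (ε * (j - i), 0))) :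
    Config.IsChain (splice ε i j α) D (splice ε i j h) (splice ε i j w) s
      (t + (ε * (j - i), 0)) := by
  have hstep : ∀ v : ℤ × ℤ, ε * (v + D.vec).1 = ε * v.1 + 1 := by
    intro v
    simp only [hD, Prod.fst_add]
    linear_combination hε
  have hstep' : ∀ v : ℤ × ℤ, ε * (v - D.vec).1 = ε * v.1 - 1 := by
    intro v
    simp only [hD, Prod.fst_sub]
    linear_combination -hε
  have hnorth : ∀ v : ℤ × ℤ, (v + Dir.north.vec).1 = v.1 := fun v => add_zero v.1
  have hdist : ∀ v : ℤ × ℤ, ε * (v + (ε * (j - i), 0)).1 = ε * v.1 + (j - i) := by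
    intro v
    simp only [Prod.fst_add]
    linear_combination (j - i) * hε
  refine ⟨fun v hv => ?_, fun v hv => ?_, fun v => ?_⟩
  -- The strict inequality matters: an edge out of column `j` ends in the shifted part, so column
  -- `j` is read as the copy of column `i`.
  · by_cases hle : ε * v.1 < j
    · have h1 : ε * (v + D.vec).1 ≤ j := by rw [hstep]; omega
      rw [ATAM.splice, if_pos hle.le] at hv
      simp only [Config.Binds, ATAM.splice, if_pos hle.le, if_pos h1]
      exact H.left v hv
    · have h1 : j ≤ ε * (v + D.vec).1 := by rw [hstep]; omega
      rw [splice_of_le hh (not_lt.1 hle)] at hv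
      simp only [Config.Binds, splice_of_le hα (not_lt.1 hle), splice_of_le hα h1]
      rw [← sub_add_eq_add_sub]
      exact H.left _ hv
  · by_cases hle : ε * v.1 ≤ j
    · rw [ATAM.splice, if_pos hle] at hv
      simp only [Config.Binds, ATAM.splice, hnorth, if_pos hle]
      exact H.right v hv
    · rw [ATAM.splice, if_neg hle] at hv
      simp only [Config.Binds, ATAM.splice, hnorth, if_neg hle]
      rw [← sub_add_eq_add_sub]
      exact H.right _ hv
  · have hn : (v - (0, 1)).1 = v.1 := sub_zero v.1
    by_cases hle : ε * v.1 ≤ j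
    · have h1 : ε * (v - D.vec).1 ≤ j := by rw [hstep']; omega
      -- On the kept side neither `t` nor its shift occurs; beyond the seam neither `s` nor its
      -- shift does. The boundary is thus `s` plus the shifted `t`.
      have hvt : v ≠ t := by rintro rfl; omega
      have hvt' : v ≠ t + (ε * (j - i), 0) := by
        intro he
        have := hdist t
        rw [← he] at this
        omega
      have := H.boundary v
      rw [pointMass_of_ne hvt] at this
      rw [pointMass_of_ne hvt', ← this]
      simp only [chainBoundary, ATAM.splice, hn, if_pos hle, if_pos h1]
    · have h1 : j ≤ ε * (v - D.vec).1 := by rw [hstep']; omega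
      have hvs : v ≠ s := by rintro rfl; omega
      have hvs' : v - (ε * (j - i), 0) ≠ s := by
        intro he
        have := hdist s
        rw [← he, sub_add_cancel] at this
        rw [he] at this
        omega
      have := H.boundary (v - (ε * (j - i), 0))
      rw [pointMass_of_ne hvs'] at this
      rw [pointMass_of_ne hvs]
      have ht' : pointMass (t + (ε * (j - i), 0)) v =
          pointMass t (v - (ε * (j - i), 0)) := by
        simp only [pointMass, sub_eq_iff_eq_add]
      rw [ht', ← this]
      simp only [chainBoundary, splice_of_le hh h1, splice_of_le hh (not_le.1 hle).le]
      simp only [ATAM.splice, hn, if_neg hle]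
      rw [sub_right_comm v D.vec, sub_right_comm v (0, 1)]

theorem Config.finite_dom_splice (hfin : α.dom.Finite) :
    (Config.dom (splice ε i j α)).Finite := by
  refine (hfin.union (hfin.image fun v => v + (ε * (j - i), 0))).subset ?_
  rintro v ⟨t, ht⟩
  unfold splice at ht
  split_ifs at ht
  · exact Or.inl ⟨t, ht⟩
  · exact Or.inr ⟨_, ⟨t, ht⟩, sub_add_cancel _ _⟩

/-- If a connected finite configuration repeats a column, then its part beyond this column can be
pushed away from the root. -/
theorem Config.IsChain.exists_rooted (H : α.IsChain D h w s t) (hfin : α.dom.Finite)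
    (hsα : s ∈ α.dom) (hD : D.vec = (ε, 0)) (hε : ε * ε = 1)
    (hij : i < j) (hs : ε * s.1 ≤ i) (ht : j < ε * t.1)
    (hα : ∀ v : ℤ × ℤ, ε * v.1 = j → α v = α (v - (ε * (j - i), 0)))
    (hh : ∀ v : ℤ × ℤ, ε * v.1 = j → h v = h (v - (ε * (j - i), 0))) :
    ∃ γ : Config A, γ.Rooted s ∧ γ s = α s ∧ (∀ p u, γ p = some u → ∃ q, α q = some u) ∧
      t + (ε * (j - i), 0) ∈ γ.dom := by
  set σ : Config A := ATAM.splice ε i j α with hσ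
  have hσs : σ s = α s := if_pos (hs.trans hij.le)
  have hsσ : s ∈ σ.dom := by
    obtain ⟨u, hu⟩ := hsα
    exact ⟨u, hσs.trans hu⟩
  refine ⟨σ.restrict (σ.component s), rooted_restrict_component hsσ, ?_, ?_, ?_⟩
  · rw [← hσs]
    exact if_pos (σ.self_mem_component s)
  · intro p u hp
    have hp := σ.restrict_sub _ p u hp
    simp only [hσ, ATAM.splice] at hp
    split_ifs at hp
    · exact ⟨_, hp⟩
    · exact ⟨_, hp⟩
  · rw [dom_restrict (component_subset hsσ)]
    exact (H.splice hD hε hij hs ht hα hh).mem_component (finite_dom_splice hfin) hsσ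

end Splice

/-! ### Counting columns -/

theorem finite_rectangle (k N : ℕ) : (rectangle k N).Finite := by
  refine ((Set.finite_Ico (0 : ℤ) N).prod (Set.finite_Ico (0 : ℤ) k)).subset ?_
  rintro p ⟨h1, h2, h3, h4⟩
  exact ⟨⟨h1, h2⟩, h3, h4⟩

/-- The distance of the seed from an end column is bounded by the number of ways to mark the bonds
that cross a column and to place tiles on it. -/
theorem TAS.SelfAssembles.distance_le {𝒯 : TAS A} {k N : ℕ}
    (hX : 𝒯.SelfAssembles (rectangle k N)) {s : ℤ × ℤ} (hs : 𝒯.seed.dom = {s})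
    (hτ : 𝒯.temp = 1) {ε : ℤ} {D : Dir} (hDD : D = .east ∨ D = .west) (hD : D.vec = (ε, 0))
    {t : ℤ × ℤ} (ht : t ∈ rectangle k N)
    (hout : ∀ d : ℤ, 0 < d → t + (ε * d, 0) ∉ rectangle k N) :
    ε * t.1 - ε * s.1 ≤ ((2 * 𝒯.tiles.card) ^ k : ℕ) := by
  classical
  have hε' : ε = 1 ∨ ε = -1 := by
    rcases hDD with rfl | rfl
    · exact Or.inl (congrArg Prod.fst hD).symm
    · exact Or.inr (congrArg Prod.fst hD).symm
  have hε : ε * ε = 1 := by rcases hε' with rfl | rfl <;> norm_num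
  have hroot := Config.rooted_of_connected 𝒯.seed_assembly.2 (hs ▸ rfl : s ∈ 𝒯.seed.dom)
  obtain ⟨β, hprod, hterm, hsub⟩ :=
    TAS.exists_terminal hs hτ 𝒯.seed_assembly.1 hroot fun _ _ h => h
  have hdom := hX β hprod hterm
  have hsβ : s ∈ β.dom := hsub.dom_subset hroot.1
  have hsR : s ∈ rectangle k N := hdom ▸ hsβ
  obtain ⟨h, w, H⟩ := (Config.rooted_of_connected hterm.1.1.2 hsβ).exists_isChain hDD
    (hdom.symm ▸ ht)
  by_contra! hlt
  -- Column `i` lies at distance `i` from the seed towards `t`. The column of `t` is left out, as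
  -- the splice requires `t` strictly beyond the seam.
  let col : ℕ → Fin k → ℤ × ℤ := fun i y => (ε * (ε * s.1 + i), y)
  have hcard : (Fintype.piFinset fun _ : Fin k =>
      (Finset.univ : Finset (ZMod 2)) ×ˢ 𝒯.tiles.map Function.Embedding.some).card <
      (Finset.range (ε * t.1 - ε * s.1).toNat).card := by
    simp only [Fintype.card_piFinset_const, Finset.card_product, Finset.card_map,
      Finset.card_univ, ZMod.card, Finset.card_range]
    omega
  obtain ⟨i, hi, j, hj, hne, hinfo⟩ := Finset.exists_ne_map_eq_of_card_lt_of_maps_to hcard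
    (f := fun i y => (h (col i y), β (col i y))) (by
      intro i hi
      simp only [Finset.coe_range, Set.mem_Iio] at hi
      simp only [Finset.mem_coe, Fintype.mem_piFinset]
      intro y
      have hmem : col i y ∈ β.dom := by
        rw [hdom]
        have hy := y.2
        obtain ⟨h1, h2, -⟩ := hsR
        obtain ⟨h3, h4, -⟩ := ht
        simp only [rectangle, Set.mem_ofPred_eq, col]
        rcases hε' with rfl | rfl <;> omega
      obtain ⟨u, hu⟩ := hmem
      simp only [Finset.mem_product, Finset.mem_univ, true_and, hu, Finset.mem_map]
      exact ⟨u, hterm.1.1.1 _ _ hu, rfl⟩)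
  have key : ∀ i j : ℕ, i < j → j < (ε * t.1 - ε * s.1).toNat →
      (∀ y, (h (col i y), β (col i y)) = (h (col j y), β (col j y))) → False := by
    intro i j hij hj hinfo
    have hrow : ∀ v : ℤ × ℤ, ε * v.1 = ε * s.1 + j →
        v - (ε * ((ε * s.1 + j) - (ε * s.1 + i)), 0) = (ε * (ε * s.1 + i), v.2) := by
      intro v hv
      ext
      · simp only [Prod.fst_sub]
        linear_combination ε * hv - v.1 * hε
      · exact sub_zero _
    have hcol : ∀ v : ℤ × ℤ, ε * v.1 = ε * s.1 + j → v = (ε * (ε * s.1 + j), v.2) := by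
      intro v hv
      ext
      · linear_combination ε * hv - v.1 * hε
      · rfl
    have hnone : ∀ v : ℤ × ℤ, ¬ (0 ≤ v.2 ∧ v.2 < k) → β v = none := by
      intro v hv
      by_contra hne
      obtain ⟨u, hu⟩ := Option.ne_none_iff_exists'.1 hne
      have : v ∈ rectangle k N := hdom ▸ ⟨u, hu⟩
      exact hv this.2.2
    -- Marked edges are bonds, so nothing is marked outside the `k` rows and the recorded data
    -- determine the whole column.
    have hzero : ∀ v : ℤ × ℤ, ¬ (0 ≤ v.2 ∧ v.2 < k) → h v = 0 := by
      intro v hv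
      by_contra hne
      obtain ⟨u, hu⟩ := (H.left v hne).mem_left
      rw [hnone v hv] at hu
      cases hu
    have hboth : ∀ v : ℤ × ℤ, ε * v.1 = ε * s.1 + j →
        β v = β (v - (ε * ((ε * s.1 + j) - (ε * s.1 + i)), 0)) ∧
        h v = h (v - (ε * ((ε * s.1 + j) - (ε * s.1 + i)), 0)) := by
      intro v hv
      rw [hrow v hv]
      by_cases hv2 : 0 ≤ v.2 ∧ v.2 < k
      · have := hinfo ⟨v.2.toNat, by omega⟩
        simp only [col, Int.toNat_of_nonneg hv2.1, Prod.mk.injEq] at this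
        rw [hcol v hv]
        exact ⟨this.2.symm, this.1.symm⟩
      · rw [hnone _ hv2, hzero _ hv2, hnone (ε * (ε * s.1 + i), v.2) hv2,
          hzero (ε * (ε * s.1 + i), v.2) hv2]
        exact ⟨rfl, rfl⟩
    obtain ⟨γ, hγ, hγs, hγT, hγt⟩ := H.exists_rooted (hdom ▸ finite_rectangle k N) hsβ hD hε
      (i := ε * s.1 + i) (j := ε * s.1 + j) (by omega) (by omega) (by omega)
      (fun v hv => (hboth v hv).1) (fun v hv => (hboth v hv).2)
    obtain ⟨β', hprod', hterm', hsub'⟩ := TAS.exists_terminal hs hτ (γ := γ) (by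
      intro p u hp
      obtain ⟨q, hq⟩ := hγT p u hp
      exact hterm.1.1.1 q u hq) hγ (by
      intro p u hp
      have hps : p ∈ 𝒯.seed.dom := ⟨u, hp⟩
      rw [hs, Set.mem_singleton_iff] at hps
      subst hps
      rw [hγs]
      exact hsub _ _ hp)
    have := hsub'.dom_subset hγt
    rw [hX β' hprod' hterm'] at this
    exact hout _ (by omega) this
  rcases lt_or_gt_of_ne hne with hlt | hlt
  · exact key i j hlt (Finset.mem_range.1 hj) fun y => congrFun hinfo y
  · exact key j i hlt (Finset.mem_range.1 hi) fun y => (congrFun hinfo y).symm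

theorem TAS.SelfAssembles.length_le {𝒯 : TAS A} {k N : ℕ} (hk : 1 ≤ k) (hN : 1 ≤ N)
    (hX : 𝒯.SelfAssembles (rectangle k N)) (hs : 𝒯.SinglySeeded) (hτ : 𝒯.temp = 1) :
    N ≤ 3 * (2 * 𝒯.tiles.card) ^ k := by
  obtain ⟨s, hs⟩ := hs
  have hpos : 0 < (2 * 𝒯.tiles.card) ^ k := by
    obtain ⟨u, hu⟩ : s ∈ 𝒯.seed.dom := hs ▸ rfl
    have := Finset.card_pos.2 ⟨u, 𝒯.seed_assembly.1 s u hu⟩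
    positivity
  have h1 := hX.distance_le hs hτ (D := .east) (Or.inl rfl) rfl (t := ((N : ℤ) - 1, 0))
    ⟨by simp; omega, by simp, by simp, by simp; omega⟩
    (fun d hd h => by have := h.2.1; simp at this; omega)
  have h2 := hX.distance_le hs hτ (D := .west) (Or.inr rfl) rfl (t := (0, 0))
    ⟨by simp, by simp; omega, by simp, by simp; omega⟩
    (fun d hd h => by have := h.1; simp at this; omega)
  simp only at h1 h2
  -- With `M = (2|T|)^k`, the two distances sum to `N - 1 ≤ 2M`, and `M ≥ 1` absorbs the remaining
  -- 1.
  omega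

/-! ### A system that assembles a given finite connected shape -/

/-- A code for the lattice edge leaving `p` in direction `d`. -/
def edgeCode (p : ℤ × ℤ) : Dir → ℕ
  | .north => Encodable.encode (p, true) + 1
  | .east => Encodable.encode (p, false) + 1
  | .south => Encodable.encode (p + Dir.south.vec, true) + 1
  | .west => Encodable.encode (p + Dir.west.vec, false) + 1

theorem edgeCode_pos (p : ℤ × ℤ) (d : Dir) : 0 < edgeCode p d := by
  cases d <;> exact Nat.succ_pos _

/-- The code names the undirected edge, so a matching glue determines the neighbouring position. It
serves as a strength rather than a label because the alphabet may be empty. -/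
theorem edgeCode_eq_iff {p q : ℤ × ℤ} {d : Dir} :
    edgeCode p d = edgeCode q d.opp ↔ q = p + d.vec := by
  obtain ⟨a, b⟩ := p
  obtain ⟨a', b'⟩ := q
  cases d <;>
    simp only [edgeCode, Dir.opp, Dir.vec, Nat.add_right_cancel_iff, Encodable.encode_inj,
      Prod.mk.injEq, Prod.mk_add_mk, and_true] <;> omega

open Classical in
/-- The tile at `p` of a system in which every edge of the set `X` has a glue of its own. -/
noncomputable def edgeTile (A : Type*) (X : Set (ℤ × ℤ)) (p : ℤ × ℤ) : TileType A :=
  fun d => ⟨[], if p + d.vec ∈ X then edgeCode p d else 0⟩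

open Classical in
/-- The configuration with domain `X` in which every edge has a glue of its own. -/
noncomputable def edgeConfig (A : Type*) (X : Set (ℤ × ℤ)) : Config A :=
  fun p => if p ∈ X then some (edgeTile A X p) else none

section EdgeConfig

variable {X : Set (ℤ × ℤ)}

theorem edgeConfig_of_mem {p : ℤ × ℤ} (hp : p ∈ X) : edgeConfig A X p = some (edgeTile A X p) :=
  if_pos hp

theorem dom_edgeConfig : (edgeConfig A X).dom = X := by
  ext p
  constructor
  · rintro ⟨t, ht⟩
    by_contra hp
    rw [edgeConfig, if_neg hp] at ht
    cases ht
  · exact fun hp => ⟨_, edgeConfig_of_mem hp⟩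

theorem binds_edgeConfig {p : ℤ × ℤ} {d : Dir} (hp : p ∈ X) (hd : p + d.vec ∈ X) :
    (edgeConfig A X).Binds p d := by
  have hback : p + d.vec + d.opp.vec ∈ X := by rwa [Dir.vec_opp, add_neg_cancel_right]
  refine ⟨_, _, edgeConfig_of_mem hp, edgeConfig_of_mem hd, ?_, ?_⟩
  · simp only [edgeTile, if_pos hd, if_pos hback, ← edgeCode_eq_iff.2 (rfl : p + d.vec = _)]
  · simp only [edgeTile, if_pos hd, edgeCode_pos]

/-- Induction from the seed: outward sides at the border of `X` have strength 0, and every other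
glue fits only the intended neighbour, so each attached tile is the prescribed one. -/
theorem eq_restrict_edgeConfig {α : Config A} {s : ℤ × ℤ}
    (hT : ∀ p t, α p = some t → ∃ q ∈ X, edgeTile A X q = t) (hα : α.Rooted s)
    (hs : s ∈ X) (hαs : α s = some (edgeTile A X s)) :
    α.dom ⊆ X ∧ α = (edgeConfig A X).restrict α.dom := by
  have key := hα.2 {p | p ∈ X ∧ α p = some (edgeTile A X p)} ⟨hs, hαs⟩ (by
    rintro p ⟨hp, hαp⟩ d ⟨t, t', h1, h2, h3, h4⟩
    obtain rfl := Option.some_injective _ (h1.symm.trans hαp)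
    obtain ⟨q, hq, rfl⟩ := hT _ _ h2
    have h5 := congrArg Glue.strength h3
    have hd : p + d.vec ∈ X := by
      by_contra hd
      simp [edgeTile, hd] at h4
    simp only [edgeTile, if_pos hd] at h5
    split_ifs at h5 with h6
    · obtain rfl := edgeCode_eq_iff.1 h5
      exact ⟨hd, h2⟩
    · exact absurd h5 (edgeCode_pos p d).ne')
  refine ⟨fun p hp => (key hp).1, ?_⟩
  funext p
  by_cases hp : p ∈ α.dom
  · rw [(key hp).2]
    exact (Config.restrict_eq_some.2 ⟨hp, edgeConfig_of_mem (key hp).1⟩).symm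
  · have : α p = none := by
      by_contra hne
      exact hp (Option.ne_none_iff_exists'.1 hne)
    rw [this]
    exact (if_neg hp).symm

/-- Every finite connected shape self-assembles in a singly-seeded system of temperature `1`. -/
theorem exists_selfAssembles (hfin : X.Finite) {s : ℤ × ℤ}
    (hX : (edgeConfig A X).Rooted s) :
    ∃ 𝒯 : TAS A, 𝒯.SinglySeeded ∧ 𝒯.temp = 1 ∧ 𝒯.SelfAssembles X := by
  classical
  have hs : s ∈ X := (dom_edgeConfig (A := A) (X := X)) ▸ hX.1
  have hsub : ({s} : Set (ℤ × ℤ)) ⊆ (edgeConfig A X).dom := Set.singleton_subset_iff.2 hX.1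
  have hT : ∀ p t, edgeConfig A X p = some t → t ∈ hfin.toFinset.image (edgeTile A X) := by
    intro p t ht
    have hp : p ∈ X := (dom_edgeConfig (A := A) (X := X)).subset ⟨t, ht⟩
    rw [edgeConfig_of_mem hp] at ht
    exact Finset.mem_image.2 ⟨p, hfin.mem_toFinset.2 hp, Option.some_injective _ ht⟩
  have hseed : ((edgeConfig A X).restrict {s}).dom = {s} := Config.dom_restrict hsub
  have hroot : ((edgeConfig A X).restrict {s}).Rooted s :=
    ⟨hseed.superset rfl, fun K hK _ => hseed.subset.trans (Set.singleton_subset_iff.2 hK)⟩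
  refine ⟨⟨hfin.toFinset.image (edgeTile A X), (edgeConfig A X).restrict {s}, 1, one_pos,
    (Set.finite_singleton s).subset hseed.subset, ⟨fun p t h => hT p t (Config.restrict_sub _ _ p t h),
    hroot.connected⟩, hroot.stable⟩, ⟨s, hseed⟩, rfl, ?_⟩
  rintro α ⟨a, len, hlen, -, h0, -, hαsub⟩ ⟨⟨⟨hαT, hαc⟩, -⟩, hfront⟩
  have hαs : α s = some (edgeTile A X s) := by
    have := hαsub 0 (by rw [hlen]; simp)
    rw [h0] at this
    exact this _ _ (Config.restrict_eq_some.2 ⟨rfl, edgeConfig_of_mem hs⟩)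
  have hαr := Config.rooted_of_connected hαc (s := s) ⟨_, hαs⟩
  obtain ⟨hαX, hα⟩ := eq_restrict_edgeConfig (fun p t h => by
    obtain ⟨q, hq, h⟩ := Finset.mem_image.1 (hαT p t h)
    exact ⟨q, hfin.mem_toFinset.1 hq, h⟩) hαr hs hαs
  refine hαX.antisymm ?_
  by_contra hne
  have hαd : α.dom ⊆ (edgeConfig A X).dom := dom_edgeConfig (A := A).symm ▸ hαX
  -- If `α` misses part of `X`, some bond of the full configuration leaves its domain, and the tile
  -- at the far end could still attach.
  obtain ⟨p, hp, d, hb, hd⟩ := hX.exists_binds hαd ⟨s, hαr.1⟩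
    (by rw [dom_edgeConfig]; exact Set.sdiff_nonempty.2 hne)
  have hr : ((edgeConfig A X).restrict (insert (p + d.vec) α.dom)).Rooted s :=
    Config.Rooted.restrict_insert hαd (hα ▸ hαr) hp hb
  have hdom := Config.dom_restrict (Set.insert_subset hb.mem_right hαd)
  have hmem : p + d.vec ∈ (∅ : Set (ℤ × ℤ)) := by
    rw [← hfront]
    refine Set.mem_iUnion₂.2 ⟨_, ⟨⟨⟨hαT, hαc⟩, hαr.stable⟩,
      ⟨⟨fun q t h => hT q t (Config.restrict_sub _ _ q t h), hr.connected⟩, hr.stable⟩, ?_,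
      p + d.vec, ?_⟩, hdom.superset (Set.mem_insert _ _), hd⟩
    · intro q t hq
      rw [hα] at hq
      exact Config.restrict_sub_restrict _ (Set.subset_insert _ _) q t hq
    · rw [hdom]
      ext x
      simp only [Set.mem_sdiff, Set.mem_insert_iff, Set.mem_singleton_iff]
      constructor
      · tauto
      · rintro rfl
        exact ⟨Or.inl rfl, hd⟩
  exact hmem

end EdgeConfig

theorem rooted_edgeConfig_rectangle {k N : ℕ} (hk : 1 ≤ k) (hN : 1 ≤ N) :
    (edgeConfig A (rectangle k N)).Rooted (0, 0) := by
  refine ⟨?_, fun K h0 hK => ?_⟩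
  · rw [dom_edgeConfig]
    simp only [rectangle, Set.mem_ofPred_eq]
    omega
  · rw [dom_edgeConfig]
    have hrow : ∀ x : ℕ, x < N → ((x : ℤ), (0 : ℤ)) ∈ K := by
      intro x
      induction x with
      | zero => exact fun _ => h0
      | succ x ih =>
        intro hx
        have := hK _ (ih (by omega)) .east (binds_edgeConfig
          (by simp only [rectangle, Set.mem_ofPred_eq]; omega)
          (by simp only [rectangle, Set.mem_ofPred_eq, Dir.vec, Prod.mk_add_mk]; omega))
        simpa [Dir.vec] using this
    have hcol : ∀ x y : ℕ, x < N → y < k → ((x : ℤ), (y : ℤ)) ∈ K := by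
      intro x y hx
      induction y with
      | zero => exact fun _ => hrow x hx
      | succ y ih =>
        intro hy
        have := hK _ (ih (by omega)) .north (binds_edgeConfig
          (by simp only [rectangle, Set.mem_ofPred_eq]; omega)
          (by simp only [rectangle, Set.mem_ofPred_eq, Dir.vec, Prod.mk_add_mk]; omega))
        simpa [Dir.vec] using this
    rintro ⟨x, y⟩ ⟨h1, h2, h3, h4⟩
    simp only at h1 h2 h3 h4
    lift x to ℕ using h1
    lift y to ℕ using h3
    exact hcol x y (by omega) (by omega)

end ATAM

/-! ### The lower bound -/

theorem theorem1 :
    ∃ c : ℝ, 0 < c ∧ ∀ (A : Type*) (k N : ℕ), 1 ≤ k → 1 ≤ N →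
      c * (N : ℝ) ^ (1 / (k : ℝ)) ≤ (ATAM.tileComplexity A 1 (ATAM.rectangle k N) : ℝ) := by
  refine ⟨1 / 6, by norm_num, fun A k N hk hN => ?_⟩
  obtain ⟨𝒯₀, h₀⟩ := ATAM.exists_selfAssembles (ATAM.finite_rectangle k N)
    (ATAM.rooted_edgeConfig_rectangle (A := A) hk hN)
  -- The infimum is attained because the set of sizes is non-empty.
  obtain ⟨𝒯, hs, hτ, hcard, hX⟩ := Nat.sInf_mem (s := {n | ∃ 𝒯 : ATAM.TAS A, 𝒯.SinglySeeded ∧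
    𝒯.temp = 1 ∧ 𝒯.tiles.card = n ∧ 𝒯.SelfAssembles (ATAM.rectangle k N)})
    ⟨_, 𝒯₀, h₀.1, h₀.2.1, rfl, h₀.2.2⟩
  rw [ATAM.tileComplexity, ← hcard]
  have hle : N ≤ (6 * 𝒯.tiles.card) ^ k := by
    calc N ≤ 3 * (2 * 𝒯.tiles.card) ^ k := hX.length_le hk hN hs hτ
      -- Absorbing the factor 3 into the power by `3 ≤ 3 ^ k` gives the constant `1 / 6`, uniform in
      -- `k`.
      _ ≤ 3 ^ k * (2 * 𝒯.tiles.card) ^ k :=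
        Nat.mul_le_mul_right _ (Nat.le_self_pow (by omega) 3)
      _ = (6 * 𝒯.tiles.card) ^ k := by rw [← mul_pow, ← mul_assoc]; norm_num
  have hroot : (N : ℝ) ^ (1 / (k : ℝ)) ≤ 6 * 𝒯.tiles.card := by
    calc (N : ℝ) ^ (1 / (k : ℝ)) ≤ (((6 * 𝒯.tiles.card : ℝ)) ^ k) ^ (1 / (k : ℝ)) :=
        Real.rpow_le_rpow (by positivity) (by exact_mod_cast hle) (by positivity)
      _ = 6 * 𝒯.tiles.card := by
        rw [one_div, Real.pow_rpow_inv_natCast (by positivity) (by omega)]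
  linarith
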